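/- Let $m\in\mathbb N$, $[m]=\{1,\dots,m\}$, let $\mathbf p=(p_1,\dots,p_m)$ be a probability vector with all $p_j>0$, and for each $j\in[m]$ let $\chi_j$ be a probability distribution on $\mathbb N_0^m$ and $S_j$ a non-empty proper subset of $[m]$. In the rooted multi-type Galton–Watson tree $\mathcal T$, the root $\phi$ has a colour $\sigma(\phi)$ with law $\mathbf p$, and every vertex $v$ of colour $\sigma(v)=i$ has, independently of all else, $X_{v,k}$ children of colour $k$ for each $k\in[m]$, where $(X_{v,1},\dots,X_{v,m})\sim\chi_i$. Edges are directed from parent to child. An edge $(u,v)$ is permissible for P1 (Stopper) if $\sigma(v)\in S_{\sigma(u)}$, and for P2 (Escaper) if $\sigma(v)\in[m]\setminus S_{\sigma(u)}$. A token is placed at a vertex, and the players alternately move it along an edge permissible for the player who moves; a player must move when she is able to. In the normal game whoever first fails to make a move loses, in the misère game whoever first fails to make a move wins, and an infinite play is a draw. In the escape game (Stopper against Escaper), Stopper wins if either player ever fails to make a move, and otherwise Escaper wins. A player wins from a given start if she has a winning strategy, and loses if her opponent has one. For $i\in\{1,2\}$ and $j\in[m]$ let $\mathrm{nw}_{i,j}$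 and $\mathrm{nl}_{i,j}$ be the probabilities, conditional on $\sigma(\phi)=j$, that P$i$ wins, respectively loses, the normal game that starts at $\phi$ with P$i$ playing the first round; let $\mathrm{mw}_{i,j}$, $\mathrm{ml}_{i,j}$ be the analogous probabilities for the misère game. Let $\mathrm{esw}_j$ be the probability, conditional on $\sigma(\phi)=j$, that Stopper wins the escape game that starts at $\phi$ with Stopper playing the first round, and $\mathrm{eel}_j$ the probability, conditional on $\sigma(\phi)=j$, that Escaper loses it when Escaper plays the first round. (All these events are measurable.) Write $\mathbf{nw}_i=(\mathrm{nw}_{i,j})_{j\in[m]}$, and similarly for the others. For $A\subseteq[m]$ let $G_{j,A}$ be the probability generating function of the marginal of $\chi_j$ on the coordinates in $A$. Let $\alpha_j$ and $\beta_j$ be the probabilities that a vertex of colour $j$ has no child with colour in $S_j$, respectively in $[m]\setminus S_j$. For $x\in[0,1]^m$ and $j\in[m]$ put $$F_{N,j}(x)=1-G_{j,S_j}\bigl(1-G_{k,[m]\setminus S_k}(x_\ell:\ell\in[m]\setminus S_k):k\in S_j\bigr),$$ $$\mathcal F_{N,j}(x)=1-G_{j,[m]\setminus S_j}\bigl(1-G_{k,S_k}(x_\ell:\ell\in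 S_k):k\in[m]\setminus S_j\bigr),$$ $$F_{M,j}(x)=\alpha_j+1-G_{j,S_j}\bigl(1-G_{k,[m]\setminus S_k}(x_\ell:\ell\in[m]\setminus S_k)+\beta_k:k\in S_j\bigr),$$ $$\mathcal F_{M,j}(x)=\beta_j+1-G_{j,[m]\setminus S_j}\bigl(1-G_{k,S_k}(x_\ell:\ell\in S_k)+\alpha_k:k\in[m]\setminus S_j\bigr),$$ $$F_{E,j}(x)=\alpha_j+1-G_{j,S_j}\bigl(1-G_{k,[m]\setminus S_k}(x_\ell:\ell\in[m]\setminus S_k):k\in S_j\bigr),$$ $$\mathcal F_{E,j}(x)=1-G_{j,[m]\setminus S_j}\bigl(\alpha_k+1-G_{k,S_k}(x_\ell:\ell\in S_k):k\in[m]\setminus S_j\bigr).$$ Then the six maps $F_N,\mathcal F_N,F_M,\mathcal F_M,F_E,\mathcal F_E$ with these coordinates map $[0,1]^m$ to itself. Let $\mathrm{FP}(f)$ be the set of fixed points of $f$ in $[0,1]^m$, and let $\min\mathrm{FP}(f)$ and $\max\mathrm{FP}(f)$ be its least and greatest elements in the coordinatewise order. All the extrema below exist, and, with $\mathbf 1$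 the all-ones vector, $$\mathbf{nw}_1=\min\mathrm{FP}(F_N),\quad \mathbf{nl}_1=\mathbf 1-\max\mathrm{FP}(F_N),\quad \mathbf{nw}_2=\min\mathrm{FP}(\mathcal F_N),\quad \mathbf{nl}_2=\mathbf 1-\max\mathrm{FP}(\mathcal F_N),$$ $$\mathbf{mw}_1=\min\mathrm{FP}(F_M),\quad \mathbf{ml}_1=\mathbf 1-\max\mathrm{FP}(F_M),\quad \mathbf{mw}_2=\min\mathrm{FP}(\mathcal F_M),\quad \mathbf{ml}_2=\mathbf 1-\max\mathrm{FP}(\mathcal F_M),$$ $$\mathbf{esw}=\min\mathrm{FP}(F_E),\quad \mathbf{eel}=\mathbf 1-\max\mathrm{FP}(\mathcal F_E).$$ -/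

import Mathlib

open MeasureTheory ProbabilityTheory

noncomputable section

namespace GWGames

/-! ### Coloured rooted trees -/

/-- Labels for the potential vertices of a rooted tree with vertex colours in `Fin m`.  The root is
`[]`, and `(k, r) :: u` is the child number `r` (counted from `0`) of colour `k` of the vertex
`u`. -/
abbrev Label (m : ℕ) : Type := List (Fin m × ℕ)

/-- The colour of the vertex with a given label, in a tree whose root has colour `c`. -/
def labelColour {m : ℕ} (c : Fin m) : Label m → Fin m
  | [] => c
  | (k, _) :: _ => k

/-- A locally finite rooted tree with vertex colours in `Fin m`: the vertex `u` has
`offspring u k` children of colour `k`.  Values at labels that are not vertices play no role. -/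
structure ColouredTree (m : ℕ) where
  rootColour : Fin m
  offspring : Label m → Fin m → ℕ

variable {m : ℕ}

/-- The colour `σ(v)`. -/
def ColouredTree.colour (T : ColouredTree m) (v : Label m) : Fin m :=
  labelColour T.rootColour v

/-- The label is a vertex of the tree. -/
def ColouredTree.IsVertex (T : ColouredTree m) : Label m → Prop
  | [] => True
  | (k, r) :: u => T.IsVertex u ∧ r < T.offspring u k

/-- `(u, v)` is a directed edge of the tree, i.e. `v` is a child of `u`. -/
def ColouredTree.Edge (T : ColouredTree m) (u v : Label m) : Prop :=
  T.IsVertex v ∧ ∃ e : Fin m × ℕ, v = e :: u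

/-! ### The games -/

/-- The two players.  In the escape game, `P1` is Stopper and `P2` is Escaper. -/
inductive Player where
  | P1
  | P2

/-- The opponent. -/
def Player.other : Player → Player
  | .P1 => .P2
  | .P2 => .P1

/-- `i.colours S j`: the colours to which player `i` may move from a vertex of colour `j`. -/
def Player.colours (S : Fin m → Finset (Fin m)) : Player → Fin m → Finset (Fin m)
  | .P1, j => S j
  | .P2, j => (S j)ᶜ

/-- `(u, v)` is a directed edge that is permissible for player `i`. -/
def Permissible (T : ColouredTree m) (S : Fin m → Finset (Fin m)) (i : Player)
    (u v : Label m) : Prop :=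
  T.Edge u v ∧ T.colour v ∈ i.colours S (T.colour u)

/-- Player `i` is able to make a move when the token is at `u`. -/
def CanMove (T : ColouredTree m) (S : Fin m → Finset (Fin m)) (i : Player) (u : Label m) : Prop :=
  ∃ v, Permissible T S i u v

/-- `s` is a strategy for player `i`: it tells her where to move from each vertex from which she is
able to move.  (In a rooted tree the position of the token determines the course of the game so
far, so that a function of the position is as general as a function of the history.) -/
def IsStrategy (T : ColouredTree m) (S : Fin m → Finset (Fin m)) (i : Player)
    (s : Label m → Label m) : Prop :=
  ∀ u, T.IsVertex u → CanMove T S i u → Permissible T S i u (s u)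

/-- The player whose turn it is after `n` completed rounds, if player `i` plays the first round. -/
def mover (i : Player) (n : ℕ) : Player :=
  if Even n then i else i.other

/-- The position of the token after `n` rounds, starting from `v`, when player `i` plays the first
round and each player `b` follows `π b`.  (Meaningful until a player fails to move.) -/
def position (i : Player) (π : Player → Label m → Label m) (v : Label m) : ℕ → Label m
  | 0 => v
  | n + 1 => π (mover i n) (position i π v n)

/-- Exactly `n` rounds are completed, and then the player to move fails to make a move, for the
first time in the game. -/
def EndsAfter (T : ColouredTree m) (S : Fin m → Finset (Fin m)) (i : Player)
    (π : Player → Label m → Label m) (v : Label m) (n : ℕ) : Prop :=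
  (∀ k < n, CanMove T S (mover i k) (position i π v k)) ∧
    ¬ CanMove T S (mover i n) (position i π v n)

/-- The three games. -/
inductive Game where
  | normal
  | misere
  | escape

/-- Player `a` wins the play which starts at `v` with player `i` moving first and in which each
player `b` follows `π b`.  Normal game: her opponent fails to move.  Misère game: she fails to
move.  Escape game: `P1` (Stopper) wins if some player fails to move, and `P2` (Escaper) wins
otherwise. -/
def WinsPlay (T : ColouredTree m) (S : Fin m → Finset (Fin m)) (i : Player)
    (π : Player → Label m → Label m) (v : Label m) : Game → Player → Prop
  | .normal, a => ∃ n, EndsAfter T S i π v n ∧ mover i n = a.other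
  | .misere, a => ∃ n, EndsAfter T S i π v n ∧ mover i n = a
  | .escape, .P1 => ∃ n, EndsAfter T S i π v n
  | .escape, .P2 => ¬ ∃ n, EndsAfter T S i π v n

/-- Player `a` wins the game `g` started at `v` with player `i` playing the first round: she has a
strategy that wins against every strategy of her opponent. -/
def WinsGame (T : ColouredTree m) (S : Fin m → Finset (Fin m)) (g : Game) (i : Player)
    (v : Label m) (a : Player) : Prop :=
  ∃ s, IsStrategy T S a s ∧
    ∀ π : Player → Label m → Label m, (∀ b, IsStrategy T S b (π b)) → π a = s →
      WinsPlay T S i π v g a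

/-- The vertices of colour `j` from which player `i`, playing the first round, wins the game `g`. -/
def winSet (T : ColouredTree m) (S : Fin m → Finset (Fin m)) (g : Game) (i : Player)
    (j : Fin m) : Set (Label m) :=
  {v | T.IsVertex v ∧ T.colour v = j ∧ WinsGame T S g i v i}

/-- The vertices of colour `j` from which player `i`, playing the first round, loses the game `g`,
i.e. her opponent wins it. -/
def lossSet (T : ColouredTree m) (S : Fin m → Finset (Fin m)) (g : Game) (i : Player)
    (j : Fin m) : Set (Label m) :=
  {v | T.IsVertex v ∧ T.colour v = j ∧ WinsGame T S g i v i.other}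

/-! ### Multi-type Galton–Watson trees -/

section Random

variable {Ω : Type*}

/-- The random data that generate a multi-type Galton–Watson tree: a root colour `c` with law `p`,
and for every label `v` and every colour `i` an offspring vector `ξ v i` with law `χ i`, to be used
by `v` if `v` is a vertex of colour `i`, all of them independent. -/
structure IsGWData [MeasurableSpace Ω] (μ : Measure Ω) (p : PMF (Fin m)) (χ : Fin m → PMF (Fin m → ℕ))
    (c : Ω → Fin m) (ξ : Label m → Fin m → Ω → (Fin m → ℕ)) : Prop where
  measurable_root : Measurable c
  measurable_offspring : ∀ v i, Measurable (ξ v i)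
  root_law : μ.map c = p.toMeasure
  offspring_law : ∀ v i, μ.map (ξ v i) = (χ i).toMeasure
  indep_offspring : iIndepFun (fun vi : Label m × Fin m => ξ vi.1 vi.2) μ
  indep_root : IndepFun c (fun ω (vi : Label m × Fin m) => ξ vi.1 vi.2 ω) μ

/-- The multi-type Galton–Watson tree: the root has colour `c`, and every vertex `v` of colour `i`
has the offspring vector `ξ v i`. -/
def gwTree (c : Ω → Fin m) (ξ : Label m → Fin m → Ω → (Fin m → ℕ)) (ω : Ω) : ColouredTree m where
  rootColour := c ω
  offspring v := ξ v (labelColour (c ω) v) ω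

/-- The event that the root belongs to the set of vertices of colour `j` from which player `i`,
playing the first round, wins the game `g`. -/
def winEvent (c : Ω → Fin m) (ξ : Label m → Fin m → Ω → (Fin m → ℕ))
    (S : Fin m → Finset (Fin m)) (g : Game) (i : Player) (j : Fin m) : Set Ω :=
  {ω | [] ∈ winSet (gwTree c ξ ω) S g i j}

/-- The event that the root belongs to the set of vertices of colour `j` from which player `i`,
playing the first round, loses the game `g`. -/
def lossEvent (c : Ω → Fin m) (ξ : Label m → Fin m → Ω → (Fin m → ℕ))
    (S : Fin m → Finset (Fin m)) (g : Game) (i : Player) (j : Fin m) : Set Ω :=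
  {ω | [] ∈ lossSet (gwTree c ξ ω) S g i j}

/-- The vector of the probabilities of the events `winEvent`, the one of index `j` being conditional
on the root having colour `j`. -/
def winProb [MeasurableSpace Ω] (μ : Measure Ω) (c : Ω → Fin m)
    (ξ : Label m → Fin m → Ω → (Fin m → ℕ))
    (S : Fin m → Finset (Fin m)) (g : Game) (i : Player) (j : Fin m) : ℝ :=
  (μ[|{ω | c ω = j}]).real (winEvent c ξ S g i j)

/-- The vector of the probabilities of the events `lossEvent`, the one of index `j` being
conditional on the root having colour `j`. -/
def lossProb [MeasurableSpace Ω] (μ : Measure Ω) (c : Ω → Fin m)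
    (ξ : Label m → Fin m → Ω → (Fin m → ℕ))
    (S : Fin m → Finset (Fin m)) (g : Game) (i : Player) (j : Fin m) : ℝ :=
  (μ[|{ω | c ω = j}]).real (lossEvent c ξ S g i j)

end Random

/-! ### Generating functions and the maps -/

/-- The probability generating function of a law on `ℕ^ι`. -/
def pgf {ι : Type*} [Fintype ι] (q : PMF (ι → ℕ)) (x : ι → ℝ) : ℝ :=
  ∑' n : ι → ℕ, (∏ i, x i ^ n i) * (q n).toReal

/-- The marginal `χ_{j,A}`: the law of the numbers of children of the colours in `A`. -/
def marginal (χ : Fin m → PMF (Fin m → ℕ)) (j : Fin m) (A : Finset (Fin m)) : PMF (A → ℕ) :=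
  (χ j).map (fun n k => n k)

/-- `G_{j,A}`, the probability generating function of `χ_{j,A}`. -/
def G (χ : Fin m → PMF (Fin m → ℕ)) (j : Fin m) (A : Finset (Fin m)) (x : A → ℝ) : ℝ :=
  pgf (marginal χ j A) x

variable (χ : Fin m → PMF (Fin m → ℕ)) (S : Fin m → Finset (Fin m))

/-- The probability that a vertex of colour `j` has no child with colour in `S j`. -/
def alpha (j : Fin m) : ℝ := (marginal χ j (S j) 0).toReal

/-- The probability that a vertex of colour `j` has no child with colour outside `S j`. -/
def beta (j : Fin m) : ℝ := (marginal χ j (S j)ᶜ 0).toReal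

/-- `F_N`. -/
def FN (x : Fin m → ℝ) (j : Fin m) : ℝ :=
  1 - G χ j (S j) (fun k => 1 - G χ k (S k)ᶜ (fun l => x l))

/-- `𝓕_N`. -/
def scriptFN (x : Fin m → ℝ) (j : Fin m) : ℝ :=
  1 - G χ j (S j)ᶜ (fun k => 1 - G χ k (S k) (fun l => x l))

/-- `F_M`. -/
def FM (x : Fin m → ℝ) (j : Fin m) : ℝ :=
  alpha χ S j + 1 - G χ j (S j) (fun k => 1 - G χ k (S k)ᶜ (fun l => x l) + beta χ S k)

/-- `𝓕_M`. -/
def scriptFM (x : Fin m → ℝ) (j : Fin m) : ℝ :=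
  beta χ S j + 1 - G χ j (S j)ᶜ (fun k => 1 - G χ k (S k) (fun l => x l) + alpha χ S k)

/-- `F_E`. -/
def FE (x : Fin m → ℝ) (j : Fin m) : ℝ :=
  alpha χ S j + 1 - G χ j (S j) (fun k => 1 - G χ k (S k)ᶜ (fun l => x l))

/-- `𝓕_E`. -/
def scriptFE (x : Fin m → ℝ) (j : Fin m) : ℝ :=
  1 - G χ j (S j)ᶜ (fun k => alpha χ S k + 1 - G χ k (S k) (fun l => x l))

/-- `FP(f)`, the set of fixed points of `f` in the cube `[0,1]^m`. -/
def FP (f : (Fin m → ℝ) → (Fin m → ℝ)) : Set (Fin m → ℝ) :=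
  {x | x ∈ Set.Icc 0 1 ∧ f x = x}

/-- `f` maps the cube `[0,1]^m` to itself. -/
def MapsCube (f : (Fin m → ℝ) → (Fin m → ℝ)) : Prop :=
  Set.MapsTo f (Set.Icc 0 1) (Set.Icc 0 1)

end GWGames

end

open GWGames

/-! For the winner `a` under consideration, each game is described by one predicate `E`: a play is
won by `a` exactly if it ends with a stuck player satisfying `E`. For the escape game this covers
Stopper's wins only, and those are the ones needed. As the tree is locally finite, `a` has a winning
strategy if and only if she can force a win within some bounded number of rounds
(`exists_winning_strategy_iff`). Hence the winning event is the increasing union of the events of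
winning within fewer than `n` rounds.

These events satisfy a recursion over the children. By the branching property
(`IsGWData.iIndep_children`, `IsGWData.measureReal_childrenEvent`) their probabilities satisfy a
recursion through the generating functions `G`. Taking complements at the opponent's turns gives
every round the same form `x ↦ 1 - G(x) + e * stuckProb`, where `e` is 0 or 1. This is an antitone
map, so two rounds make up a monotone continuous self-map of the cube. The six maps are its
instances.

Iterating this map from 0 gives the probabilities that the first mover wins within `2n` rounds, so
their limit is the least fixed point. Iterating from 1 gives the complements of the probabilities
that she loses within `2n` rounds, so their limit is the greatest fixed point. -/

noncomputable section

namespace GWGames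

variable {m : ℕ}

/-! ### Determinacy: winning strategies and wins in boundedly many rounds. -/

section Games

variable {T : ColouredTree m} {S : Fin m → Finset (Fin m)} {a i : Player} {E : Player → Prop}

theorem Player.other_other (i : Player) : i.other.other = i := by cases i <;> rfl

theorem Player.other_ne (i : Player) : i.other ≠ i := by cases i <;> simp [Player.other]

theorem Player.ne_iff_eq_other {i a : Player} : i ≠ a ↔ i = a.other := by
  cases i <;> cases a <;> simp [Player.other]

theorem mover_succ (i : Player) (n : ℕ) : mover i (n + 1) = mover i.other n := by
  unfold mover
  by_cases h : Even n <;> simp [Nat.even_add_one, h, Player.other_other]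

theorem position_succ (i : Player) (π : Player → Label m → Label m) (v : Label m) (n : ℕ) :
    position i π v (n + 1) = position i.other π (π i v) n := by
  induction n with
  | zero => rfl
  | succ n ih =>
    rw [position, ih, mover_succ]
    rfl

theorem endsAfter_zero {π : Player → Label m → Label m} {v : Label m} :
    EndsAfter T S i π v 0 ↔ ¬ CanMove T S i v := by
  simp [EndsAfter, mover, position]

theorem endsAfter_succ {π : Player → Label m → Label m} {v : Label m} {n : ℕ} :
    EndsAfter T S i π v (n + 1) ↔ CanMove T S i v ∧ EndsAfter T S i.other π (π i v) n := by
  simp only [EndsAfter, Nat.forall_lt_succ_left', mover_succ, position_succ, and_assoc]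
  simp [mover, position]

/-- Player `a` wins, within fewer than `n` rounds, the game with mover `i` at `v` in which a play
that ends because player `b` is unable to move is a win of `a` exactly if `E b` holds. -/
def WinsWithin (T : ColouredTree m) (S : Fin m → Finset (Fin m)) (a : Player) (E : Player → Prop) :
    ℕ → Player → Label m → Prop
  | 0, _, _ => False
  | n + 1, i, v =>
    (i = a → (¬ CanMove T S i v ∧ E i) ∨
      ∃ w, Permissible T S i v w ∧ WinsWithin T S a E n i.other w) ∧
    (i ≠ a → (¬ CanMove T S i v → E i) ∧
      ∀ w, Permissible T S i v w → WinsWithin T S a E n i.other w)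

theorem WinsWithin.succ {n : ℕ} {v : Label m} (h : WinsWithin T S a E n i v) :
    WinsWithin T S a E (n + 1) i v := by
  induction n generalizing i v with
  | zero => exact h.elim
  | succ n ih =>
    refine ⟨fun hi => (h.1 hi).imp_right ?_, fun hi => (h.2 hi).imp_right ?_⟩
    · rintro ⟨w, hw, hw'⟩
      exact ⟨w, hw, ih hw'⟩
    · exact fun H w hw => ih (H w hw)

theorem WinsWithin.mono {n k : ℕ} (hnk : n ≤ k) {v : Label m} (h : WinsWithin T S a E n i v) :
    WinsWithin T S a E k i v := by
  induction k, hnk using Nat.le_induction with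
  | base => exact h
  | succ k _ ih => exact ih.succ

theorem permissible_iff {v w : Label m} (hv : T.IsVertex v) :
    Permissible T S i v w ↔
      ∃ l ∈ i.colours S (T.colour v), ∃ r < T.offspring v l, w = (l, r) :: v := by
  constructor
  · rintro ⟨⟨hw, ⟨l, r⟩, rfl⟩, hc⟩
    exact ⟨l, hc, r, hw.2, rfl⟩
  · rintro ⟨l, hl, r, hr, rfl⟩
    exact ⟨⟨⟨hv, hr⟩, _, rfl⟩, hl⟩

theorem finite_permissible {v : Label m} (hv : T.IsVertex v) :
    {w | Permissible T S i v w}.Finite := by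
  have : {w | Permissible T S i v w} ⊆
      ⋃ l : Fin m, (fun r => (l, r) :: v) '' Set.Iio (T.offspring v l) := by
    intro w hw
    obtain ⟨l, -, r, hr, rfl⟩ := (permissible_iff hv).1 hw
    exact Set.mem_iUnion.2 ⟨l, r, hr, rfl⟩
  exact (Set.finite_iUnion fun l => (Set.finite_Iio _).image _).subset this

/-- If each move of the opponent leads to a win of `a`, then the number of rounds is bounded. -/
theorem exists_winsWithin_of_forall {v : Label m} (hv : T.IsVertex v)
    (h : ∀ w, Permissible T S i v w → ∃ n, WinsWithin T S a E n i.other w) :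
    ∃ n, ∀ w, Permissible T S i v w → WinsWithin T S a E n i.other w := by
  choose! f hf using h
  -- Local finiteness enters here: finitely many moves have a common bound.
  obtain ⟨n, hn⟩ := ((finite_permissible (S := S) (i := i) hv).image f).bddAbove
  exact ⟨n, fun w hw => (hf w hw).mono (hn ⟨w, hw, rfl⟩)⟩

/-- Used with `Q` the set of vertices from which the opponent cannot force a win: a strategy that
enters `Q` whenever a move allows it, and makes any legal move otherwise. -/
theorem exists_isStrategy (T : ColouredTree m) (S : Fin m → Finset (Fin m)) (i : Player)
    (Q : Label m → Prop) :
    ∃ s, IsStrategy T S i s ∧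
      ∀ v, (∃ w, Permissible T S i v w ∧ Q w) → Permissible T S i v (s v) ∧ Q (s v) := by
  have : ∀ v, ∃ w, (CanMove T S i v → Permissible T S i v w) ∧
      ((∃ w, Permissible T S i v w ∧ Q w) → Permissible T S i v w ∧ Q w) := by
    intro v
    by_cases h : ∃ w, Permissible T S i v w ∧ Q w
    · obtain ⟨w, hw⟩ := h
      exact ⟨w, fun _ => hw.1, fun _ => hw⟩
    · by_cases h' : CanMove T S i v
      · obtain ⟨w, hw⟩ := h'
        exact ⟨w, fun _ => hw, fun H => (h H).elim⟩
      · exact ⟨v, fun H => (h' H).elim, fun H => (h H).elim⟩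
  choose s hs using this
  exact ⟨s, fun u _ => (hs u).1, fun v => (hs v).2⟩

/-- There is a strategy that always moves to a vertex of least rank. -/
theorem exists_optimal_strategy (T : ColouredTree m) (S : Fin m → Finset (Fin m)) (a : Player)
    (E : Player → Prop) :
    ∃ s, IsStrategy T S a s ∧ ∀ n v, (∃ w, Permissible T S a v w ∧ WinsWithin T S a E n a.other w) →
      WinsWithin T S a E n a.other (s v) := by
  classical
  have : ∀ v, ∃ w, (CanMove T S a v → Permissible T S a v w) ∧
      ∀ n, (∃ w, Permissible T S a v w ∧ WinsWithin T S a E n a.other w) →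
        WinsWithin T S a E n a.other w := by
    intro v
    by_cases h : ∃ n w, Permissible T S a v w ∧ WinsWithin T S a E n a.other w
    · obtain ⟨w, hw⟩ := Nat.find_spec h
      exact ⟨w, fun _ => hw.1, fun n hn => hw.2.mono (Nat.find_min' h hn)⟩
    · by_cases h' : CanMove T S a v
      · obtain ⟨w, hw⟩ := h'
        exact ⟨w, fun _ => hw, fun n hn => (h ⟨n, hn⟩).elim⟩
      · exact ⟨v, fun H => (h' H).elim, fun n hn => (h ⟨n, hn⟩).elim⟩
  choose s hs using this
  exact ⟨s, fun u _ => (hs u).1, fun n v => (hs v).2 n⟩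

theorem Permissible.isVertex {v w : Label m} (h : Permissible T S i v w) : T.IsVertex w := h.1.1

/-- The bound `n` drops by one in every round, by the choice of `π a` when `a` moves and after any
move of the opponent. The play must therefore end, and end in favour of `a`. -/
theorem WinsWithin.exists_endsAfter {π : Player → Label m → Label m}
    (hπ : ∀ b, IsStrategy T S b (π b))
    (hopt : ∀ n v, (∃ w, Permissible T S a v w ∧ WinsWithin T S a E n a.other w) →
      WinsWithin T S a E n a.other (π a v))
    {n : ℕ} {v : Label m} (hv : T.IsVertex v) (h : WinsWithin T S a E n i v) :
    ∃ k, EndsAfter T S i π v k ∧ E (mover i k) := by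
  induction n generalizing i v with
  | zero => exact h.elim
  | succ n ih =>
    by_cases hc : CanMove T S i v
    · have hp := hπ i v hv hc
      have hw : WinsWithin T S a E n i.other (π i v) := by
        by_cases hi : i = a
        · subst hi
          exact hopt n v ((h.1 rfl).resolve_left fun H => H.1 hc)
        · exact (h.2 hi).2 _ hp
      obtain ⟨k, hk, hE⟩ := ih hp.isVertex hw
      exact ⟨k + 1, endsAfter_succ.2 ⟨hc, hk⟩, by rwa [mover_succ]⟩
    · refine ⟨0, endsAfter_zero.2 hc, ?_⟩
      change E i
      by_cases hi : i = a
      · refine (h.1 hi).elim (fun H => H.2) ?_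
        rintro ⟨w, hw, -⟩
        exact (hc ⟨w, hw⟩).elim
      · exact (h.2 hi).1 hc

/-- Not being won by `a` within any bound is invariant along the play. A move of `a` cannot leave
this set of positions, and her opponent has a move inside it unless he is stuck, since otherwise
`exists_winsWithin_of_forall` would give a bound. A stuck position with `E` is won with bound 1, so
the play never ends in one. -/
theorem not_exists_endsAfter {π : Player → Label m → Label m}
    (hπ : ∀ b, IsStrategy T S b (π b))
    (hopt : ∀ v, (∃ w, Permissible T S a.other v w ∧ ¬ ∃ n, WinsWithin T S a E n a w) →
      ¬ ∃ n, WinsWithin T S a E n a (π a.other v))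
    {k : ℕ} {v : Label m} (hv : T.IsVertex v) (h : ¬ ∃ n, WinsWithin T S a E n i v)
    (hk : EndsAfter T S i π v k) : ¬ E (mover i k) := by
  induction k generalizing i v with
  | zero =>
    rw [endsAfter_zero] at hk
    change ¬ E i
    intro hE
    refine h ⟨1, fun hi => Or.inl ⟨hk, hE⟩, fun hi => ⟨fun _ => hE, fun w hw => ?_⟩⟩
    exact (hk ⟨w, hw⟩).elim
  | succ k ih =>
    obtain ⟨hc, hk⟩ := endsAfter_succ.1 hk
    have hp := hπ i v hv hc
    rw [mover_succ]
    refine ih hp.isVertex ?_ hk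
    by_cases hi : i = a
    · rintro ⟨n, hn⟩
      exact h ⟨n + 1, fun _ => Or.inr ⟨_, hp, hn⟩, fun hi' => (hi' hi).elim⟩
    · obtain rfl := Player.ne_iff_eq_other.1 hi
      rw [Player.other_other]
      refine hopt v ?_
      by_contra! H
      obtain ⟨n, hn⟩ := exists_winsWithin_of_forall (a := a) (E := E) hv
        (i := a.other) (fun w hw => by rw [Player.other_other]; exact H w hw)
      exact h ⟨n + 1, fun hi' => (hi hi').elim, fun _ => ⟨fun hc' => (hc' hc).elim, hn⟩⟩

theorem exists_winning_strategy_iff (E : Player → Prop) {v : Label m} (hv : T.IsVertex v) :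
    (∃ s, IsStrategy T S a s ∧
      ∀ π : Player → Label m → Label m, (∀ b, IsStrategy T S b (π b)) → π a = s →
        ∃ k, EndsAfter T S i π v k ∧ E (mover i k)) ↔
    ∃ n, WinsWithin T S a E n i v := by
  constructor
  · rintro ⟨s, hs, H⟩
    by_contra h
    obtain ⟨t, ht, hopt⟩ := exists_isStrategy T S a.other fun w => ¬ ∃ n, WinsWithin T S a E n a w
    classical
    let π : Player → Label m → Label m := fun b => if b = a then s else t
    have hπa : π a = s := if_pos rfl
    have hπo : π a.other = t := if_neg (Player.other_ne a)
    have hπ : ∀ b, IsStrategy T S b (π b) := by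
      intro b
      by_cases hb : b = a
      · rw [hb, hπa]; exact hs
      · rw [Player.ne_iff_eq_other.1 hb, hπo]; exact ht
    obtain ⟨k, hk, hE⟩ := H π hπ hπa
    exact not_exists_endsAfter hπ (fun v hv' => hπo ▸ (hopt v hv').2) hv h hk hE
  · rintro ⟨n, hn⟩
    obtain ⟨s, hs, hopt⟩ := exists_optimal_strategy T S a E
    exact ⟨s, hs, fun π hπ hπa => hn.exists_endsAfter hπ (hπa ▸ hopt) hv⟩

/-- Whether `a` wins a play of the game that ends because the given player is unable to move. -/
def Game.WinsIfStuck : Game → Player → Player → Prop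
  | .normal, a, i => i = a.other
  | .misere, a, i => i = a
  | .escape, a, _ => a = .P1

/-- Escaper is excluded because he wins the infinite plays, which no condition on the stuck player
describes. -/
theorem winsGame_iff {g : Game} (hg : g = .escape → a = .P1) {v : Label m} (hv : T.IsVertex v) :
    WinsGame T S g i v a ↔ ∃ n, WinsWithin T S a (g.WinsIfStuck a) n i v := by
  rw [← exists_winning_strategy_iff _ hv]
  have : ∀ π, WinsPlay T S i π v g a ↔
      ∃ k, EndsAfter T S i π v k ∧ g.WinsIfStuck a (mover i k) := by
    intro π
    cases g with
    | normal => rfl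
    | misere => rfl
    | escape => obtain rfl := hg rfl; simp [WinsPlay, Game.WinsIfStuck]
  simp only [WinsGame, this]

end Games

/-- Induction on the finite set of blocks: a new block is disjoint from the union of the others, so
two-block independence splits off one factor. -/
theorem iIndep_biSup_of_pairwiseDisjoint {Ω ι κ : Type*} {mΩ : MeasurableSpace Ω} {μ : Measure Ω}
    [IsProbabilityMeasure μ] {M : ι → MeasurableSpace Ω} (hle : ∀ i, M i ≤ mΩ) (h : iIndep M μ)
    {A : κ → Set ι} (hA : Pairwise (Function.onFun Disjoint A)) :
    iIndep (fun k => ⨆ i ∈ A k, M i) μ := by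
  classical
  rw [iIndep_iff]
  intro s
  induction s using Finset.induction_on with
  | empty => simp
  | insert b s hb ih =>
    intro f hf
    rw [Finset.set_biInter_insert, Finset.prod_insert hb,
      ← ih fun i hi => hf i (Finset.mem_insert_of_mem hi)]
    have hd : Disjoint (A b) (⋃ k ∈ s, A k) := by
      rw [Set.disjoint_iUnion₂_right]
      exact fun k hk => hA fun hbk => hb (hbk ▸ hk)
    refine (Indep_iff _ _ μ).1 (indep_iSup_of_disjoint hle h hd) _ _
      (hf b (Finset.mem_insert_self b s)) ?_
    refine Finset.measurableSet_biInter (m := _) s fun k hk => ?_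
    have hmono : (⨆ i ∈ A k, M i) ≤ ⨆ i ∈ ⋃ k ∈ s, A k, M i :=
      biSup_mono fun i hi => Set.mem_biUnion hk hi
    exact hmono _ (hf k (Finset.mem_insert_of_mem hk))

/-! ### The events of winning within `n` rounds and the branching property. -/

section Random

variable {Ω : Type*} {ξ : Label m → Fin m → Ω → (Fin m → ℕ)} {S : Fin m → Finset (Fin m)}

/-- The event that a vertex `v` of colour `k` has no children to which player `i` may move. -/
def stuckEvent (ξ : Label m → Fin m → Ω → (Fin m → ℕ)) (A : Finset (Fin m)) (k : Fin m)
    (v : Label m) : Set Ω :=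
  {ω | ∀ l : A, ξ v k ω l = 0}

/-- The event that all the children of the vertex `v` of colour `k` with colours in `A` are such that
the corresponding event in `Q` occurs. -/
def childrenEvent (ξ : Label m → Fin m → Ω → (Fin m → ℕ)) (A : Finset (Fin m))
    (Q : Fin m → Label m → Set Ω) (k : Fin m) (v : Label m) : Set Ω :=
  {ω | ∀ l : A, ∀ r < ξ v k ω l, ω ∈ Q l ((l.1, r) :: v)}

theorem stuckEvent_subset_childrenEvent (A : Finset (Fin m)) (Q : Fin m → Label m → Set Ω)
    (k : Fin m) (v : Label m) : stuckEvent ξ A k v ⊆ childrenEvent ξ A Q k v := by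
  intro ω hω l r hr
  rw [hω l] at hr
  exact absurd hr (Nat.not_lt_zero r)

/-- The event that player `a` wins within fewer than `n` rounds from the vertex `v`, if it
has colour `k`. -/
def winsWithinEvent (ξ : Label m → Fin m → Ω → (Fin m → ℕ)) (S : Fin m → Finset (Fin m))
    (a : Player) (E : Player → Prop) : ℕ → Player → Fin m → Label m → Set Ω
  | 0, _, _, _ => ∅
  | n + 1, i, k, v =>
    -- The case of `a` moving is written as a complement, so that both cases reduce to an event
    -- "stuck implies `P`, and all children satisfy `Q`" with one common probability formula.
    {ω | (i = a → ω ∉ {ω | ω ∈ stuckEvent ξ (i.colours S k) k v → ¬ E i} ∩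
        childrenEvent ξ (i.colours S k) (fun l w => (winsWithinEvent ξ S a E n i.other l w)ᶜ) k v) ∧
      (i ≠ a → ω ∈ {ω | ω ∈ stuckEvent ξ (i.colours S k) k v → E i} ∩
        childrenEvent ξ (i.colours S k) (winsWithinEvent ξ S a E n i.other) k v)}

/-- The event on the right is defined at every label, vertex or not, with a prescribed colour. It
thus depends only on offspring vectors at and below `v`, not on the root colour, and its probability
will not depend on `v`. Permissible moves lead to vertices, so the induction closes. -/
theorem winsWithin_gwTree_iff {a : Player} {E : Player → Prop} {c : Ω → Fin m} {ω : Ω} {n : ℕ}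
    {i : Player} {v : Label m} (hv : (gwTree c ξ ω).IsVertex v) :
    WinsWithin (gwTree c ξ ω) S a E n i v ↔
      ω ∈ winsWithinEvent ξ S a E n i (labelColour (c ω) v) v := by
  induction n generalizing i v with
  | zero => rfl
  | succ n ih =>
    have hperm := fun w => permissible_iff (S := S) (i := i) (w := w) hv
    have hcan : ¬ CanMove (gwTree c ξ ω) S i v ↔
        ω ∈ stuckEvent ξ (i.colours S (labelColour (c ω) v)) (labelColour (c ω) v) v := by
      simp only [CanMove, hperm, stuckEvent, Set.mem_ofPred_eq, Subtype.forall]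
      constructor
      · intro h l hl
        by_contra h0
        exact h ⟨_, l, hl, 0, Nat.pos_of_ne_zero h0, rfl⟩
      · rintro h ⟨w, l, hl, r, hr, rfl⟩
        have : (gwTree c ξ ω).offspring v l = 0 := h l hl
        omega
    have hchild : ∀ P : Label m → Prop, (∀ w, Permissible (gwTree c ξ ω) S i v w → P w) ↔
        ∀ l : i.colours S (labelColour (c ω) v), ∀ r < ξ v (labelColour (c ω) v) ω l,
          P ((l.1, r) :: v) := by
      intro P
      simp only [hperm, Subtype.forall]
      constructor
      · exact fun h l hl r hr => h _ ⟨l, hl, r, hr, rfl⟩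
      · rintro h w ⟨l, hl, r, hr, rfl⟩
        exact h l hl r hr
    have hsub : ∀ w, Permissible (gwTree c ξ ω) S i v w →
        (WinsWithin (gwTree c ξ ω) S a E n i.other w ↔
          ω ∈ winsWithinEvent ξ S a E n i.other (labelColour (c ω) w) w) :=
      fun w hw => ih hw.isVertex
    have h1 : (∃ w, Permissible (gwTree c ξ ω) S i v w ∧
        WinsWithin (gwTree c ξ ω) S a E n i.other w) ↔
        ¬ ∀ w, Permissible (gwTree c ξ ω) S i v w →
          ω ∉ winsWithinEvent ξ S a E n i.other (labelColour (c ω) w) w := by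
      push Not
      exact exists_congr fun w => and_congr_right (hsub w)
    have h2 : (∀ w, Permissible (gwTree c ξ ω) S i v w →
        WinsWithin (gwTree c ξ ω) S a E n i.other w) ↔
        ∀ w, Permissible (gwTree c ξ ω) S i v w →
          ω ∈ winsWithinEvent ξ S a E n i.other (labelColour (c ω) w) w :=
      forall_congr' fun w => imp_congr_right (hsub w)
    rw [WinsWithin, h1, h2, hcan, hchild, hchild, winsWithinEvent]
    simp only [Set.mem_ofPred_eq, Set.mem_inter_iff, childrenEvent, Set.mem_compl_iff, labelColour]
    tauto

/-- The σ-algebra generated by the offspring vectors of the vertices in the subtree of `v`. -/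
@[reducible]
def subtreeSigma (ξ : Label m → Fin m → Ω → (Fin m → ℕ)) (v : Label m) : MeasurableSpace Ω :=
  ⨆ ui ∈ {ui : Label m × Fin m | v <:+ ui.1}, MeasurableSpace.comap (ξ ui.1 ui.2) inferInstance

theorem comap_le_subtreeSigma (v : Label m) (k : Fin m) :
    MeasurableSpace.comap (ξ v k) inferInstance ≤ subtreeSigma ξ v :=
  le_biSup (fun ui : Label m × Fin m => MeasurableSpace.comap (ξ ui.1 ui.2) inferInstance)
    (show (v, k) ∈ {ui : Label m × Fin m | v <:+ ui.1} from List.suffix_rfl)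

theorem subtreeSigma_anti {v w : Label m} (h : v <:+ w) : subtreeSigma ξ w ≤ subtreeSigma ξ v :=
  biSup_mono fun _ hui => h.trans hui

theorem subtreeSigma_le [mΩ : MeasurableSpace Ω] (hξ : ∀ v i, Measurable (ξ v i)) (v : Label m) :
    subtreeSigma ξ v ≤ mΩ :=
  iSup₂_le fun ui _ => (hξ ui.1 ui.2).comap_le

theorem measurableSet_comap_offspring (v : Label m) (k : Fin m) (P : (Fin m → ℕ) → Prop) :
    MeasurableSet[MeasurableSpace.comap (ξ v k) inferInstance] {ω | P (ξ v k ω)} :=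
  ⟨{n | P n}, (Set.to_countable _).measurableSet, rfl⟩

theorem measurableSet_stuckEvent (A : Finset (Fin m)) (k : Fin m) (v : Label m) :
    MeasurableSet[subtreeSigma ξ v] (stuckEvent ξ A k v) :=
  comap_le_subtreeSigma v k _ (measurableSet_comap_offspring v k fun n => ∀ l : A, n l = 0)

theorem measurableSet_imp_stuckEvent (A : Finset (Fin m)) (k : Fin m) (v : Label m) (P : Prop) :
    MeasurableSet[subtreeSigma ξ v] {ω | ω ∈ stuckEvent ξ A k v → P} :=
  MeasurableSet.imp (m := subtreeSigma ξ v) (measurableSet_stuckEvent A k v) (MeasurableSet.const P)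

theorem measurableSet_childrenEvent {A : Finset (Fin m)} {Q : Fin m → Label m → Set Ω}
    (hQ : ∀ l w, MeasurableSet[subtreeSigma ξ w] (Q l w)) (k : Fin m) (v : Label m) :
    MeasurableSet[subtreeSigma ξ v] (childrenEvent ξ A Q k v) := by
  have : childrenEvent ξ A Q k v =
      ⋂ l : A, ⋂ r : ℕ, {ω | r < ξ v k ω l}ᶜ ∪ Q l ((l.1, r) :: v) := by
    ext ω
    simp [childrenEvent, imp_iff_not_or]
  rw [this]
  refine MeasurableSet.iInter fun l => MeasurableSet.iInter fun r => ?_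
  refine MeasurableSet.union (MeasurableSet.compl ?_) ?_
  · exact comap_le_subtreeSigma v k _ (measurableSet_comap_offspring v k fun n => r < n l)
  · exact subtreeSigma_anti (List.suffix_cons _ _) _ (hQ _ _)

theorem measurableSet_winsWithinEvent (a : Player) (E : Player → Prop) (n : ℕ) (i : Player)
    (k : Fin m) (v : Label m) :
    MeasurableSet[subtreeSigma ξ v] (winsWithinEvent ξ S a E n i k v) := by
  induction n generalizing i k v with
  | zero => exact @MeasurableSet.empty _ (subtreeSigma ξ v)
  | succ n ih =>
    have hstuck := fun P => measurableSet_imp_stuckEvent (ξ := ξ) (i.colours S k) k v P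
    refine MeasurableSet.inter ?_ ?_
    · refine MeasurableSet.imp (MeasurableSet.const _) (MeasurableSet.compl ?_)
      exact (hstuck _).inter (measurableSet_childrenEvent (fun l w => (ih _ l w).compl) k v)
    · refine MeasurableSet.imp (MeasurableSet.const _) ?_
      exact (hstuck _).inter (measurableSet_childrenEvent (fun l w => ih _ l w) k v)

variable [mΩ : MeasurableSpace Ω] {μ : Measure Ω} {p : PMF (Fin m)}
  {χ : Fin m → PMF (Fin m → ℕ)} {c : Ω → Fin m}

theorem IsGWData.measureReal_offspring_eq (h : IsGWData μ p χ c ξ) (A : Finset (Fin m)) (v : Label m)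
    (k : Fin m) (n : A → ℕ) :
    μ.real {ω | ∀ l : A, ξ v k ω l = n l} = (marginal χ k A n).toReal := by
  have hmeas : Measurable fun (n : Fin m → ℕ) (l : A) => n l := by fun_prop
  rw [marginal, ← PMF.toMeasure_apply_singleton _ _ (measurableSet_singleton n),
    ← PMF.toMeasure_map _ _ hmeas, ← h.offspring_law v k, Measure.map_map hmeas
    (h.measurable_offspring v k), Measure.map_apply (hmeas.comp (h.measurable_offspring v k))
    (measurableSet_singleton n), Measure.real]
  congr 2
  ext ω
  simp [funext_iff]

variable [IsProbabilityMeasure μ]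

/-- The offspring vector of `v` (index `none`) and the subtrees of its potential children use
disjoint sets of labels. -/
theorem IsGWData.iIndep_children (h : IsGWData μ p χ c ξ) (v : Label m) (k : Fin m) :
    iIndep (fun e : Option (Fin m × ℕ) =>
      e.elim (MeasurableSpace.comap (ξ v k) inferInstance) fun e => subtreeSigma ξ (e :: v)) μ := by
  have h0 := h.indep_offspring
  rw [iIndepFun_iff_iIndep] at h0
  have := iIndep_biSup_of_pairwiseDisjoint (fun vi => (h.measurable_offspring vi.1 vi.2).comap_le)
    h0 (κ := Option (Fin m × ℕ))
    (A := fun e => e.elim {(v, k)} fun e => {ui : Label m × Fin m | (e :: v) <:+ ui.1}) ?_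
  · convert this using 2 with e
    cases e with
    | none => simp
    | some e => rfl
  · have hnone : ∀ e : Fin m × ℕ, ¬ (e :: v) <:+ v := fun e he => by
      have := he.length_le
      simp at this
    rintro (_ | e) (_ | f) hef
    · exact (hef rfl).elim
    · exact Set.disjoint_left.2 fun x hx hx' => hnone f (by simp_all)
    · exact Set.disjoint_left.2 fun x hx' hx => hnone e (by simp_all)
    · refine Set.disjoint_left.2 fun x hx hx' => hef ?_
      -- Two suffixes of the same list with equal length coincide.
      have := (List.suffix_of_suffix_length_le hx hx' (by simp)).eq_of_length (by simp)
      simp_all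

/-- Split according to the numbers `n` of children with colours in `A`. For given `n` the event is a
finite intersection of independent events, which yields one term of the generating function. -/
theorem IsGWData.measureReal_childrenEvent (h : IsGWData μ p χ c ξ) (A : Finset (Fin m))
    {Q : Fin m → Label m → Set Ω} (hQ : ∀ l w, MeasurableSet[subtreeSigma ξ w] (Q l w))
    {y : Fin m → ℝ} (hy : ∀ l w, μ.real (Q l w) = y l) (k : Fin m) (v : Label m) :
    μ.real (childrenEvent ξ A Q k v) = G χ k A fun l => y l := by
  have hle := subtreeSigma_le h.measurable_offspring
  have hN : ∀ n : A → ℕ, MeasurableSet {ω | ∀ l : A, ξ v k ω l = n l} := fun n =>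
    (comap_le_subtreeSigma v k).trans (hle v) _
      (measurableSet_comap_offspring v k fun x => ∀ l : A, x l = n l)
  have hU : (⋃ n : A → ℕ, {ω | ∀ l : A, ξ v k ω l = n l}) = Set.univ :=
    Set.eq_univ_of_forall fun ω => Set.mem_iUnion.2 ⟨fun l => ξ v k ω l, fun l => rfl⟩
  have hd : Pairwise (Function.onFun Disjoint
      fun n : A → ℕ => {ω | ∀ l : A, ξ v k ω l = n l}) := by
    refine fun n n' hnn' => Set.disjoint_left.2 fun ω hω hω' => hnn' (funext fun l => ?_)
    exact (hω l).symm.trans (hω' l)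
  have key : ∀ n : A → ℕ, μ.real (childrenEvent ξ A Q k v ∩ {ω | ∀ l : A, ξ v k ω l = n l}) =
      (∏ l : A, y l ^ n l) * (marginal χ k A n).toReal := by
    intro n
    -- The children with colours in `A` that exist when their numbers are `n`.
    let s : Finset (Fin m × ℕ) := (Finset.univ : Finset A).biUnion fun l =>
      (Finset.range (n l)).map ⟨fun r => (l.1, r), fun r r' hr => (Prod.ext_iff.1 hr).2⟩
    let f : Option (Fin m × ℕ) → Set Ω := fun e =>
      e.elim {ω | ∀ l : A, ξ v k ω l = n l} fun e => Q e.1 (e :: v)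
    have hset : childrenEvent ξ A Q k v ∩ {ω | ∀ l : A, ξ v k ω l = n l} =
        ⋂ e ∈ Finset.insertNone s, f e := by
      ext ω
      simp only [Set.mem_inter_iff, Set.mem_iInter, childrenEvent, Set.mem_ofPred_eq]
      constructor
      · rintro ⟨h1, h2⟩ (_ | e) he
        · exact h2
        · simp only [Finset.some_mem_insertNone, s, Finset.mem_biUnion, Finset.mem_map,
            Finset.mem_range] at he
          obtain ⟨l, -, r, hr, rfl⟩ := he
          exact h1 l r (by rw [h2]; exact hr)
      · intro H
        have h2 : ∀ l : A, ξ v k ω l = n l := H none (by simp)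
        refine ⟨fun l r hr => H (some (l.1, r)) ?_, h2⟩
        simp only [Finset.some_mem_insertNone, s, Finset.mem_biUnion, Finset.mem_map,
          Finset.mem_range]
        exact ⟨l, Finset.mem_univ _, r, by rwa [← h2], rfl⟩
    have hind := (h.iIndep_children v k).meas_biInter (S := Finset.insertNone s) (s := f) (by
      rintro (_ | e) _
      · exact measurableSet_comap_offspring v k fun x => ∀ l : A, x l = n l
      · exact hQ _ _)
    rw [hset, Measure.real, hind, ENNReal.toReal_prod, Finset.prod_insertNone, mul_comm]
    congr 1
    · rw [Finset.prod_biUnion]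
      · refine Finset.prod_congr rfl fun l _ => ?_
        rw [Finset.prod_map]
        refine (Finset.prod_congr rfl fun r _ => hy l.1 _).trans ?_
        simp
      · intro l _ l' _ hll'
        refine Finset.disjoint_left.2 fun e he he' => hll' ?_
        simp only [Finset.mem_map, Finset.mem_range] at he he'
        obtain ⟨r, -, rfl⟩ := he
        obtain ⟨r', -, hr'⟩ := he'
        exact Subtype.ext (Prod.ext_iff.1 hr').1.symm
    · exact h.measureReal_offspring_eq A v k n
  have hE : MeasurableSet (childrenEvent ξ A Q k v) := hle v _ (measurableSet_childrenEvent hQ k v)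
  have hsum : HasSum (fun n : A → ℕ =>
      μ.real (childrenEvent ξ A Q k v ∩ {ω | ∀ l : A, ξ v k ω l = n l}))
      (μ.real (childrenEvent ξ A Q k v)) := by
    have h1 : μ (childrenEvent ξ A Q k v) =
        ∑' n : A → ℕ, μ (childrenEvent ξ A Q k v ∩ {ω | ∀ l : A, ξ v k ω l = n l}) := by
      rw [← measure_iUnion (fun n n' hnn' => (hd hnn').mono Set.inter_subset_right
        Set.inter_subset_right) fun n => hE.inter (hN n), ← Set.inter_iUnion, hU, Set.inter_univ]
    have h2 := ENNReal.hasSum_toReal (h1 ▸ measure_ne_top μ (childrenEvent ξ A Q k v))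
    rwa [← ENNReal.tsum_toReal_eq (fun n => measure_ne_top μ _), ← h1] at h2
  rw [← hsum.tsum_eq, G, pgf]
  exact tsum_congr key

/-- The probability that player `i` has no move at a vertex of a given colour. -/
def stuckProb (χ : Fin m → PMF (Fin m → ℕ)) (S : Fin m → Finset (Fin m)) (i : Player) (k : Fin m) :
    ℝ :=
  (marginal χ k (i.colours S k) 0).toReal

open Classical in
-- A stuck vertex satisfies the condition on its children vacuously. If `P` fails, the event is a
-- difference of nested events and the probabilities subtract.
theorem IsGWData.measureReal_imp_inter_childrenEvent (h : IsGWData μ p χ c ξ) (P : Prop) (i : Player)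
    {Q : Fin m → Label m → Set Ω} (hQ : ∀ l w, MeasurableSet[subtreeSigma ξ w] (Q l w))
    {y : Fin m → ℝ} (hy : ∀ l w, μ.real (Q l w) = y l) (k : Fin m) (v : Label m) :
    μ.real ({ω | ω ∈ stuckEvent ξ (i.colours S k) k v → P} ∩
        childrenEvent ξ (i.colours S k) Q k v) =
      G χ k (i.colours S k) (fun l => y l) - (if P then 0 else 1) * stuckProb χ S i k := by
  have hle := subtreeSigma_le h.measurable_offspring
  rw [← h.measureReal_childrenEvent (i.colours S k) hQ hy k v]
  by_cases hP : P
  · simp [hP]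
  · have h1 : {ω | ω ∈ stuckEvent ξ (i.colours S k) k v → P} ∩
        childrenEvent ξ (i.colours S k) Q k v =
        childrenEvent ξ (i.colours S k) Q k v \ stuckEvent ξ (i.colours S k) k v := by
      ext ω
      simp [hP, and_comm]
    rw [h1, measureReal_sdiff (stuckEvent_subset_childrenEvent _ _ _ _)
      (hle v _ (measurableSet_stuckEvent _ _ _)), if_neg hP, one_mul, stuckProb]
    congr 1
    exact h.measureReal_offspring_eq (i.colours S k) v k 0

open Classical in
/-- The probabilities of the events `winsWithinEvent`. -/
def winsWithinProb (χ : Fin m → PMF (Fin m → ℕ)) (S : Fin m → Finset (Fin m)) (a : Player)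
    (E : Player → Prop) : ℕ → Player → Fin m → ℝ
  | 0, _, _ => 0
  | n + 1, i, k =>
    if i = a then
      1 - G χ k (i.colours S k) (fun l => 1 - winsWithinProb χ S a E n i.other l)
        + (if E i then 1 else 0) * stuckProb χ S i k
    else
      G χ k (i.colours S k) (fun l => winsWithinProb χ S a E n i.other l)
        - (if E i then 0 else 1) * stuckProb χ S i k

/-- Induction on `n` for all labels at once: offspring laws depend on the colour only, so all
children of one colour contribute the same argument to `G`. -/
theorem IsGWData.measureReal_winsWithinEvent (h : IsGWData μ p χ c ξ) (a : Player)
    (E : Player → Prop) (n : ℕ) (i : Player) (k : Fin m) (v : Label m) :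
    μ.real (winsWithinEvent ξ S a E n i k v) = winsWithinProb χ S a E n i k := by
  classical
  have hle := subtreeSigma_le h.measurable_offspring
  have hm := fun n i k v => measurableSet_winsWithinEvent (ξ := ξ) (S := S) a E n i k v
  induction n generalizing i k v with
  | zero => simp [winsWithinEvent, winsWithinProb]
  | succ n ih =>
    by_cases hi : i = a
    · have hset : winsWithinEvent ξ S a E (n + 1) i k v =
          ({ω | ω ∈ stuckEvent ξ (i.colours S k) k v → ¬ E i} ∩
          childrenEvent ξ (i.colours S k)
            (fun l w => (winsWithinEvent ξ S a E n i.other l w)ᶜ) k v)ᶜ := by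
        ext ω
        rw [winsWithinEvent]
        simp only [Set.mem_ofPred_eq, hi, ne_eq, not_true_eq_false, forall_true_left,
          IsEmpty.forall_iff, and_true]
        rfl
      have hms := (measurableSet_imp_stuckEvent (ξ := ξ) (i.colours S k) k v (¬ E i)).inter
        (measurableSet_childrenEvent (A := i.colours S k)
          (fun l w => (hm n i.other l w).compl) k v)
      rw [hset, probReal_compl_eq_one_sub (hle v _ hms),
        h.measureReal_imp_inter_childrenEvent _ i (fun l w => (hm n i.other l w).compl)
          (y := fun l => 1 - winsWithinProb χ S a E n i.other l)
          (fun l w => by rw [probReal_compl_eq_one_sub (hle w _ (hm _ _ _ _)), ih]),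
        winsWithinProb, if_pos hi]
      by_cases hE : E i
      · simp [hE]
        ring
      · simp [hE]
    · have hset : winsWithinEvent ξ S a E (n + 1) i k v =
          {ω | ω ∈ stuckEvent ξ (i.colours S k) k v → E i} ∩
          childrenEvent ξ (i.colours S k) (winsWithinEvent ξ S a E n i.other) k v := by
        ext ω
        rw [winsWithinEvent]
        simp only [Set.mem_ofPred_eq, hi, ne_eq, not_false_eq_true, forall_true_left,
          IsEmpty.forall_iff, true_and]
      rw [hset, h.measureReal_imp_inter_childrenEvent _ i (fun l w => hm n i.other l w)
        (fun l w => ih _ _ _), winsWithinProb, if_neg hi]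

end Random

/-! ### Generating functions on the cube. -/

section Pgf

variable {ι : Type*} [Fintype ι] (q : PMF (ι → ℕ))

theorem hasSum_toReal_pmf {α : Type*} (q : PMF α) : HasSum (fun n => (q n).toReal) 1 := by
  have := ENNReal.hasSum_toReal (f := q) q.tsum_coe_ne_top
  rwa [← ENNReal.tsum_toReal_eq q.apply_ne_top, q.tsum_coe, ENNReal.toReal_one] at this

theorem prod_pow_mem_Icc {x : ι → ℝ} (hx : x ∈ Set.Icc 0 1) (n : ι → ℕ) :
    ∏ i, x i ^ n i ∈ Set.Icc (0 : ℝ) 1 :=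
  ⟨Finset.prod_nonneg fun i _ => pow_nonneg (hx.1 i) _,
    Finset.prod_le_one (fun i _ => pow_nonneg (hx.1 i) _)
      fun i _ => pow_le_one₀ (hx.1 i) (hx.2 i)⟩

theorem summable_pgf {x : ι → ℝ} (hx : x ∈ Set.Icc 0 1) :
    Summable fun n : ι → ℕ => (∏ i, x i ^ n i) * (q n).toReal :=
  Summable.of_nonneg_of_le
    (fun n => mul_nonneg (prod_pow_mem_Icc hx n).1 ENNReal.toReal_nonneg)
    (fun n => mul_le_of_le_one_left ENNReal.toReal_nonneg (prod_pow_mem_Icc hx n).2)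
    (hasSum_toReal_pmf q).summable

theorem pgf_le_one {x : ι → ℝ} (hx : x ∈ Set.Icc 0 1) : pgf q x ≤ 1 :=
  (hasSum_toReal_pmf q).tsum_eq ▸ (summable_pgf q hx).tsum_le_tsum
    (fun n => mul_le_of_le_one_left ENNReal.toReal_nonneg (prod_pow_mem_Icc hx n).2)
    (hasSum_toReal_pmf q).summable

/-- The left side is the term `n = 0` of a series with nonnegative terms. This bound keeps `1 - G +
stuckProb` at most 1. -/
theorem apply_zero_le_pgf {x : ι → ℝ} (hx : x ∈ Set.Icc 0 1) : (q 0).toReal ≤ pgf q x := by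
  have := (summable_pgf q hx).le_tsum 0
    fun n _ => mul_nonneg (prod_pow_mem_Icc hx n).1 ENNReal.toReal_nonneg
  rw [pgf]
  simpa using this

theorem pgf_mono {x y : ι → ℝ} (hx : x ∈ Set.Icc 0 1) (hy : y ∈ Set.Icc 0 1) (hxy : x ≤ y) :
    pgf q x ≤ pgf q y :=
  (summable_pgf q hx).tsum_le_tsum (fun _ => mul_le_mul_of_nonneg_right
    (Finset.prod_le_prod (fun i _ => pow_nonneg (hx.1 i) _)
      fun i _ => pow_le_pow_left₀ (hx.1 i) (hxy i) _) ENNReal.toReal_nonneg) (summable_pgf q hy)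

/-- Weierstrass test with the weights of `q` as majorant, valid up to the boundary of the cube. -/
theorem continuousOn_pgf : ContinuousOn (pgf q) (Set.Icc 0 1) := by
  refine continuousOn_tsum (fun n => Continuous.continuousOn (by fun_prop))
    (hasSum_toReal_pmf q).summable fun n x hx => ?_
  rw [Real.norm_of_nonneg (mul_nonneg (prod_pow_mem_Icc hx n).1 ENNReal.toReal_nonneg)]
  exact mul_le_of_le_one_left ENNReal.toReal_nonneg (prod_pow_mem_Icc hx n).2

end Pgf

/-! ### Extremal fixed points as limits of iterates. -/

section FixedPoints

open Filter Topology

variable {f : (Fin m → ℝ) → (Fin m → ℝ)} {u : ℕ → Fin m → ℝ} {L : Fin m → ℝ}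

theorem mem_FP_of_tendsto (hf : ContinuousOn f (Set.Icc 0 1)) (hmem : ∀ n, u n ∈ Set.Icc 0 1)
    (hs : ∀ n, u (n + 1) = f (u n)) (hL : Tendsto u atTop (𝓝 L)) : L ∈ FP f := by
  have hLm : L ∈ Set.Icc 0 1 := isClosed_Icc.mem_of_tendsto hL (Eventually.of_forall hmem)
  refine ⟨hLm, tendsto_nhds_unique ?_ ((tendsto_add_atTop_iff_nat 1).2 hL)⟩
  simp only [hs]
  exact (hf L hLm).tendsto.comp
    (tendsto_nhdsWithin_iff.2 ⟨hL, Eventually.of_forall hmem⟩)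

/-- By monotonicity no iterate of 0 exceeds any fixed point, so neither does the limit, which is
itself fixed by continuity. Convergence is a hypothesis because it comes from the probabilities. -/
theorem isLeast_FP_of_tendsto (hmaps : MapsCube f) (hmono : MonotoneOn f (Set.Icc 0 1))
    (hf : ContinuousOn f (Set.Icc 0 1)) (h0 : u 0 = 0) (hs : ∀ n, u (n + 1) = f (u n))
    (hL : Tendsto u atTop (𝓝 L)) : IsLeast (FP f) L := by
  have hmem : ∀ n, u n ∈ Set.Icc 0 1 := fun n => by
    induction n with
    | zero => rw [h0]; exact ⟨le_rfl, zero_le_one⟩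
    | succ n ih => exact hs n ▸ hmaps ih
  refine ⟨mem_FP_of_tendsto hf hmem hs hL, fun x hx => le_of_tendsto' hL fun n => ?_⟩
  induction n with
  | zero => exact h0 ▸ hx.1.1
  | succ n ih => exact hs n ▸ (hmono (hmem n) hx.1 ih).trans_eq hx.2

theorem isGreatest_FP_of_tendsto (hmaps : MapsCube f) (hmono : MonotoneOn f (Set.Icc 0 1))
    (hf : ContinuousOn f (Set.Icc 0 1)) (h0 : u 0 = 1) (hs : ∀ n, u (n + 1) = f (u n))
    (hL : Tendsto u atTop (𝓝 L)) : IsGreatest (FP f) L := by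
  have hmem : ∀ n, u n ∈ Set.Icc 0 1 := fun n => by
    induction n with
    | zero => rw [h0]; exact ⟨zero_le_one, le_rfl⟩
    | succ n ih => exact hs n ▸ hmaps ih
  refine ⟨mem_FP_of_tendsto hf hmem hs hL, fun x hx => ge_of_tendsto' hL fun n => ?_⟩
  induction n with
  | zero => exact h0 ▸ hx.1.2
  | succ n ih => exact hs n ▸ hx.2.ge.trans (hmono hx.1 (hmem n) ih)

end FixedPoints

/-! ### One round and two rounds of the recursion. -/

section GameMap

variable (χ : Fin m → PMF (Fin m → ℕ)) (S : Fin m → Finset (Fin m)) (i : Player) {e : ℝ}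

/-- The common form of one round of the six maps. -/
def roundMap (χ : Fin m → PMF (Fin m → ℕ)) (S : Fin m → Finset (Fin m)) (i : Player) (e : ℝ)
    (x : Fin m → ℝ) (k : Fin m) : ℝ :=
  1 - G χ k (i.colours S k) (fun l => x l) + e * stuckProb χ S i k

/-- The common form of the six maps. -/
def gameMap (χ : Fin m → PMF (Fin m → ℕ)) (S : Fin m → Finset (Fin m)) (i : Player) (e e' : ℝ)
    (x : Fin m → ℝ) : Fin m → ℝ :=
  roundMap χ S i e (roundMap χ S i.other e' x)

theorem restrict_mem_Icc {A : Finset (Fin m)} {x : Fin m → ℝ} (hx : x ∈ Set.Icc 0 1) :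
    (fun l : A => x l) ∈ Set.Icc 0 1 :=
  ⟨fun l => hx.1 l, fun l => hx.2 l⟩

theorem mapsCube_roundMap (he : e ∈ Set.Icc (0 : ℝ) 1) : MapsCube (roundMap χ S i e) := by
  intro x hx
  have h1 : ∀ k, G χ k (i.colours S k) (fun l => x l) ≤ 1 :=
    fun k => pgf_le_one _ (restrict_mem_Icc hx)
  have h2 : ∀ k, stuckProb χ S i k ≤ G χ k (i.colours S k) (fun l => x l) :=
    fun k => apply_zero_le_pgf _ (restrict_mem_Icc hx)
  have h3 : ∀ k, 0 ≤ stuckProb χ S i k := fun k => ENNReal.toReal_nonneg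
  refine ⟨fun k => ?_, fun k => ?_⟩
  · have := mul_nonneg he.1 (h3 k)
    simp only [roundMap, Pi.zero_apply]
    linarith [h1 k]
  · have := mul_le_of_le_one_left (h3 k) he.2
    simp only [roundMap, Pi.one_apply]
    linarith [h2 k]

theorem antitoneOn_roundMap : AntitoneOn (roundMap χ S i e) (Set.Icc 0 1) := by
  intro x hx y hy hxy k
  have : G χ k (i.colours S k) (fun l => x l) ≤ G χ k (i.colours S k) (fun l => y l) :=
    pgf_mono _ (restrict_mem_Icc hx) (restrict_mem_Icc hy) fun l => hxy l
  simp only [roundMap]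
  linarith

theorem continuousOn_roundMap : ContinuousOn (roundMap χ S i e) (Set.Icc 0 1) := by
  refine continuousOn_pi.2 fun k => ?_
  refine (continuousOn_const.sub ?_).add continuousOn_const
  have hrestrict : Continuous fun (x : Fin m → ℝ) (l : i.colours S k) => x l := by fun_prop
  exact (continuousOn_pgf (marginal χ k (i.colours S k))).comp hrestrict.continuousOn
    fun x hx => restrict_mem_Icc hx

variable {e' : ℝ}

theorem mapsCube_gameMap (he : e ∈ Set.Icc (0 : ℝ) 1) (he' : e' ∈ Set.Icc (0 : ℝ) 1) :
    MapsCube (gameMap χ S i e e') :=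
  (mapsCube_roundMap χ S i he).comp (mapsCube_roundMap χ S i.other he')

theorem monotoneOn_gameMap (he' : e' ∈ Set.Icc (0 : ℝ) 1) :
    MonotoneOn (gameMap χ S i e e') (Set.Icc 0 1) := fun _ hx _ hy hxy =>
  antitoneOn_roundMap χ S i (mapsCube_roundMap χ S i.other he' hy)
    (mapsCube_roundMap χ S i.other he' hx) (antitoneOn_roundMap χ S i.other hx hy hxy)

theorem continuousOn_gameMap (he' : e' ∈ Set.Icc (0 : ℝ) 1) :
    ContinuousOn (gameMap χ S i e e') (Set.Icc 0 1) :=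
  (continuousOn_roundMap χ S i).comp (continuousOn_roundMap χ S i.other)
    (mapsCube_roundMap χ S i.other he')

open Classical in
theorem winsWithinProb_succ_self (a : Player) (E : Player → Prop) (n : ℕ) :
    winsWithinProb χ S a E (n + 1) a =
      roundMap χ S a (if E a then 1 else 0) (1 - winsWithinProb χ S a E n a.other) := by
  funext k
  simp [winsWithinProb, roundMap]

open Classical in
-- Complementing turns the opponent's recursion `G - stuckProb` or `G` into the form of `roundMap`.
-- The coefficient is 1 exactly if the stuck opponent does not give `a` the win.
theorem one_sub_winsWithinProb_succ_other (a : Player) (E : Player → Prop) (n : ℕ) :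
    1 - winsWithinProb χ S a E (n + 1) a.other =
      roundMap χ S a.other (if E a.other then 0 else 1) (winsWithinProb χ S a E n a) := by
  funext k
  simp only [Pi.sub_apply, Pi.one_apply, winsWithinProb, roundMap, if_neg (Player.other_ne a),
    Player.other_other]
  ring

open Classical in
theorem winsWithinProb_add_two_self (a : Player) (E : Player → Prop) (n : ℕ) :
    winsWithinProb χ S a E (n + 2) a =
      gameMap χ S a (if E a then 1 else 0) (if E a.other then 0 else 1)
        (winsWithinProb χ S a E n a) := by
  rw [winsWithinProb_succ_self, one_sub_winsWithinProb_succ_other, gameMap]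

open Classical in
theorem one_sub_winsWithinProb_add_two_other (a : Player) (E : Player → Prop) (n : ℕ) :
    1 - winsWithinProb χ S a E (n + 2) a.other =
      gameMap χ S a.other (if E a.other then 0 else 1) (if E a then 1 else 0)
        (1 - winsWithinProb χ S a E n a.other) := by
  rw [one_sub_winsWithinProb_succ_other, winsWithinProb_succ_self, gameMap, Player.other_other]

end GameMap

/-! ### The six maps as instances of `gameMap`. -/

section MapIdentities

variable (χ : Fin m → PMF (Fin m → ℕ)) (S : Fin m → Finset (Fin m))

theorem FN_eq : FN χ S = gameMap χ S .P1 0 0 := by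
  funext x k
  simp only [FN, gameMap, roundMap, zero_mul, add_zero]
  rfl

theorem scriptFN_eq : scriptFN χ S = gameMap χ S .P2 0 0 := by
  funext x k
  simp only [scriptFN, gameMap, roundMap, zero_mul, add_zero]
  rfl

theorem FM_eq : FM χ S = gameMap χ S .P1 1 1 := by
  funext x k
  simp only [FM, gameMap, roundMap, one_mul, add_comm (alpha χ S k), add_sub_right_comm]
  -- `alpha` and `beta` are `stuckProb` for `.P1` and `.P2` by definition.
  rfl

theorem scriptFM_eq : scriptFM χ S = gameMap χ S .P2 1 1 := by
  funext x k
  simp only [scriptFM, gameMap, roundMap, one_mul, add_comm (beta χ S k), add_sub_right_comm]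
  rfl

theorem FE_eq : FE χ S = gameMap χ S .P1 1 0 := by
  funext x k
  simp only [FE, gameMap, roundMap, one_mul, zero_mul, add_zero, add_comm (alpha χ S k),
    add_sub_right_comm]
  rfl

theorem scriptFE_eq : scriptFE χ S = gameMap χ S .P2 0 1 := by
  funext x k
  simp only [scriptFE, gameMap, roundMap, one_mul, zero_mul, add_zero, add_comm (alpha χ S _),
    add_sub_right_comm]
  rfl

end MapIdentities

/-! ### Winning and losing probabilities as limits of the recursion. -/

section Probabilities

open Filter Topology

variable {Ω : Type*} {c : Ω → Fin m} {ξ : Label m → Fin m → Ω → (Fin m → ℕ)}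
  {S : Fin m → Finset (Fin m)} {g : Game} {a i : Player} {j : Fin m} {E : Player → Prop}

/-- The event that player `a` wins the game `g` at the root with mover `i`, if the root has
colour `j`. -/
theorem setOf_winsGame_root_eq (hg : g = .escape → a = .P1) :
    {ω | c ω = j ∧ WinsGame (gwTree c ξ ω) S g i [] a} =
      {ω | c ω = j} ∩ ⋃ n, winsWithinEvent ξ S a (g.WinsIfStuck a) n i j [] := by
  ext ω
  simp only [Set.mem_ofPred_eq, Set.mem_inter_iff, Set.mem_iUnion]
  refine and_congr_right fun hc => ?_
  rw [winsGame_iff hg (v := []) trivial]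
  refine exists_congr fun n => ?_
  rw [winsWithin_gwTree_iff (v := []) trivial, labelColour, hc]

theorem winEvent_eq (hg : g = .escape → i = .P1) : winEvent c ξ S g i j =
    {ω | c ω = j} ∩ ⋃ n, winsWithinEvent ξ S i (g.WinsIfStuck i) n i j [] := by
  rw [← setOf_winsGame_root_eq hg]
  ext ω
  simp [winEvent, winSet, ColouredTree.IsVertex, ColouredTree.colour, labelColour, gwTree]

theorem lossEvent_eq (hg : g = .escape → i.other = .P1) : lossEvent c ξ S g i j =
    {ω | c ω = j} ∩ ⋃ n, winsWithinEvent ξ S i.other (g.WinsIfStuck i.other) n i j [] := by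
  rw [← setOf_winsGame_root_eq hg]
  ext ω
  simp [lossEvent, lossSet, ColouredTree.IsVertex, ColouredTree.colour, labelColour, gwTree]

theorem winsWithinEvent_subset_succ (a : Player) (E : Player → Prop) (n : ℕ) (i : Player)
    (k : Fin m) (v : Label m) :
    winsWithinEvent ξ S a E n i k v ⊆ winsWithinEvent ξ S a E (n + 1) i k v := by
  induction n generalizing i k v with
  | zero => exact Set.empty_subset _
  | succ n ih =>
    rintro ω ⟨h1, h2⟩
    refine ⟨fun hi H => h1 hi ⟨H.1, fun l r hr hQ => H.2 l r hr (ih _ _ _ hQ)⟩,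
      fun hi => ⟨(h2 hi).1, fun l r hr => ih _ _ _ ((h2 hi).2 l r hr)⟩⟩

theorem measurableSet_iUnion_winsWithinEvent (a : Player) (E : Player → Prop) (i : Player)
    (j : Fin m) :
    MeasurableSet[subtreeSigma ξ []] (⋃ n, winsWithinEvent ξ S a E n i j []) :=
  MeasurableSet.iUnion fun n => measurableSet_winsWithinEvent a E n i j []

variable [mΩ : MeasurableSpace Ω] {μ : Measure Ω} {p : PMF (Fin m)} {χ : Fin m → PMF (Fin m → ℕ)}

theorem IsGWData.measurableSet_root_inter (h : IsGWData μ p χ c ξ) (a : Player)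
    (E : Player → Prop) (i : Player) (j : Fin m) :
    MeasurableSet ({ω | c ω = j} ∩ ⋃ n, winsWithinEvent ξ S a E n i j []) :=
  (h.measurable_root (measurableSet_singleton j)).inter
    (subtreeSigma_le h.measurable_offspring [] _ (measurableSet_iUnion_winsWithinEvent a E i j))

theorem IsGWData.measure_root_eq (h : IsGWData μ p χ c ξ) (j : Fin m) : μ {ω | c ω = j} = p j := by
  rw [← PMF.toMeasure_apply_singleton p j (measurableSet_singleton j), ← h.root_law,
    Measure.map_apply h.measurable_root (measurableSet_singleton j)]
  rfl

theorem IsGWData.measurableSet_winEvent (h : IsGWData μ p χ c ξ) (hg : g = .escape → i = .P1)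
    (j : Fin m) : MeasurableSet (winEvent c ξ S g i j) := by
  rw [winEvent_eq hg]
  exact h.measurableSet_root_inter _ _ _ _

theorem IsGWData.measurableSet_lossEvent (h : IsGWData μ p χ c ξ)
    (hg : g = .escape → i.other = .P1) (j : Fin m) : MeasurableSet (lossEvent c ξ S g i j) := by
  rw [lossEvent_eq hg]
  exact h.measurableSet_root_inter _ _ _ _

variable [IsProbabilityMeasure μ]

/-- The root colour is independent of all offspring vectors, so conditioning on it has no effect on
an event that they determine. -/
theorem IsGWData.cond_root_inter (h : IsGWData μ p χ c ξ) (hp : p j ≠ 0) {B : Set Ω}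
    (hB : MeasurableSet[subtreeSigma ξ []] B) :
    (μ[|{ω | c ω = j}]).real ({ω | c ω = j} ∩ B) = μ.real B := by
  have hc : MeasurableSet {ω | c ω = j} := h.measurable_root (measurableSet_singleton j)
  have hle : subtreeSigma ξ [] ≤
      MeasurableSpace.comap (fun ω (vi : Label m × Fin m) => ξ vi.1 vi.2 ω) inferInstance := by
    refine iSup₂_le fun ui _ => ?_
    rintro _ ⟨s, hs, rfl⟩
    exact ⟨(fun x => x ui) ⁻¹' s, measurable_pi_apply ui hs, rfl⟩
  have hind := (Indep_iff _ _ μ).1 ((IndepFun_iff_Indep _ _ _).1 h.indep_root) {ω | c ω = j} B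
    ⟨{j}, measurableSet_singleton j, rfl⟩ (hle _ hB)
  have h0 : μ {ω | c ω = j} ≠ 0 := by rwa [h.measure_root_eq]
  rw [Measure.real, cond_apply hc, ← Set.inter_assoc, Set.inter_self, hind, ← mul_assoc,
    ENNReal.inv_mul_cancel h0 (measure_ne_top _ _), one_mul, Measure.real]

/-- Continuity of the measure from below along the increasing events. -/
theorem IsGWData.tendsto_winsWithinProb (h : IsGWData μ p χ c ξ) (a : Player) (E : Player → Prop)
    (i : Player) :
    Tendsto (fun n => winsWithinProb χ S a E n i) atTop
      (𝓝 fun j => μ.real (⋃ n, winsWithinEvent ξ S a E n i j [])) := by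
  refine tendsto_pi_nhds.2 fun j => ?_
  simp only [← h.measureReal_winsWithinEvent a E _ i j []]
  exact (ENNReal.tendsto_toReal (measure_ne_top _ _)).comp (tendsto_measure_iUnion_atTop
    (monotone_nat_of_le_succ fun n => winsWithinEvent_subset_succ a E n i j []))

theorem IsGWData.winProb_eq (h : IsGWData μ p χ c ξ) (hp : ∀ j, p j ≠ 0)
    (hg : g = .escape → i = .P1) :
    winProb μ c ξ S g i =
      fun j => μ.real (⋃ n, winsWithinEvent ξ S i (g.WinsIfStuck i) n i j []) := by
  funext j
  rw [winProb, winEvent_eq hg,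
    h.cond_root_inter (hp j) (measurableSet_iUnion_winsWithinEvent _ _ _ _)]

theorem IsGWData.lossProb_eq (h : IsGWData μ p χ c ξ) (hp : ∀ j, p j ≠ 0)
    (hg : g = .escape → i.other = .P1) :
    lossProb μ c ξ S g i =
      fun j => μ.real (⋃ n, winsWithinEvent ξ S i.other (g.WinsIfStuck i.other) n i j []) := by
  funext j
  rw [lossProb, lossEvent_eq hg,
    h.cond_root_inter (hp j) (measurableSet_iUnion_winsWithinEvent _ _ _ _)]

theorem ite_one_zero_mem_Icc (P : Prop) [Decidable P] :
    (if P then (1 : ℝ) else 0) ∈ Set.Icc (0 : ℝ) 1 := by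
  split_ifs <;> simp

theorem ite_zero_one_mem_Icc (P : Prop) [Decidable P] :
    (if P then (0 : ℝ) else 1) ∈ Set.Icc (0 : ℝ) 1 := by
  split_ifs <;> simp

open Classical in
theorem IsGWData.isLeast_winProb (h : IsGWData μ p χ c ξ) (hp : ∀ j, p j ≠ 0)
    (hg : g = .escape → i = .P1) :
    IsLeast (FP (gameMap χ S i (if g.WinsIfStuck i i then 1 else 0)
      (if g.WinsIfStuck i i.other then 0 else 1))) (winProb μ c ξ S g i) := by
  rw [h.winProb_eq hp hg]
  refine isLeast_FP_of_tendsto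
    -- Even indices only, because one application of `gameMap` accounts for two rounds.
    (u := fun n => winsWithinProb χ S i (g.WinsIfStuck i) (2 * n) i)
    (mapsCube_gameMap χ S i (ite_one_zero_mem_Icc _) (ite_zero_one_mem_Icc _))
    (monotoneOn_gameMap χ S i (ite_zero_one_mem_Icc _))
    (continuousOn_gameMap χ S i (ite_zero_one_mem_Icc _)) rfl
    (fun n => winsWithinProb_add_two_self χ S i _ (2 * n)) ?_
  exact (h.tendsto_winsWithinProb i _ i).comp
    (tendsto_id.const_mul_atTop' two_pos)

open Classical in
theorem IsGWData.isGreatest_one_sub_lossProb (h : IsGWData μ p χ c ξ) (hp : ∀ j, p j ≠ 0)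
    (hg : g = .escape → i.other = .P1) :
    IsGreatest (FP (gameMap χ S i (if g.WinsIfStuck i.other i then 0 else 1)
      (if g.WinsIfStuck i.other i.other then 1 else 0))) (1 - lossProb μ c ξ S g i) := by
  rw [h.lossProb_eq hp hg]
  refine isGreatest_FP_of_tendsto
    -- The winner is now the opponent of the first mover. Her win probability starts at 0, so the
    -- complement starts at 1.
    (u := fun n => 1 - winsWithinProb χ S i.other (g.WinsIfStuck i.other) (2 * n) i)
    (mapsCube_gameMap χ S i (ite_zero_one_mem_Icc _) (ite_one_zero_mem_Icc _))
    (monotoneOn_gameMap χ S i (ite_one_zero_mem_Icc _))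
    (continuousOn_gameMap χ S i (ite_one_zero_mem_Icc _)) ?_ (fun n => ?_) ?_
  · funext k
    simp [winsWithinProb]
  · have := one_sub_winsWithinProb_add_two_other χ S i.other (g.WinsIfStuck i.other) (2 * n)
    rwa [Player.other_other] at this
  · exact tendsto_const_nhds.sub ((h.tendsto_winsWithinProb i.other _ i).comp
      (tendsto_id.const_mul_atTop' two_pos))

end Probabilities

end GWGames

end

theorem theorem1 {m : ℕ} (p : PMF (Fin m)) (hp : ∀ j, p j ≠ 0)
    (χ : Fin m → PMF (Fin m → ℕ)) (S : Fin m → Finset (Fin m))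
    (hS : ∀ j, (S j).Nonempty ∧ S j ≠ Finset.univ)
    {Ω : Type*} [MeasurableSpace Ω] (μ : Measure Ω) [IsProbabilityMeasure μ]
    (c : Ω → Fin m) (ξ : Label m → Fin m → Ω → (Fin m → ℕ)) (hGW : IsGWData μ p χ c ξ) :
    -- the normal game
    ((∀ i j, MeasurableSet (winEvent c ξ S .normal i j) ∧
        MeasurableSet (lossEvent c ξ S .normal i j)) ∧
      MapsCube (FN χ S) ∧ MapsCube (scriptFN χ S) ∧
      IsLeast (FP (FN χ S)) (winProb μ c ξ S .normal .P1) ∧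
      (∃ M, IsGreatest (FP (FN χ S)) M ∧ lossProb μ c ξ S .normal .P1 = 1 - M) ∧
      IsLeast (FP (scriptFN χ S)) (winProb μ c ξ S .normal .P2) ∧
      (∃ M, IsGreatest (FP (scriptFN χ S)) M ∧ lossProb μ c ξ S .normal .P2 = 1 - M)) ∧
    -- the misère game
    ((∀ i j, MeasurableSet (winEvent c ξ S .misere i j) ∧
        MeasurableSet (lossEvent c ξ S .misere i j)) ∧
      MapsCube (FM χ S) ∧ MapsCube (scriptFM χ S) ∧
      IsLeast (FP (FM χ S)) (winProb μ c ξ S .misere .P1) ∧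
      (∃ M, IsGreatest (FP (FM χ S)) M ∧ lossProb μ c ξ S .misere .P1 = 1 - M) ∧
      IsLeast (FP (scriptFM χ S)) (winProb μ c ξ S .misere .P2) ∧
      (∃ M, IsGreatest (FP (scriptFM χ S)) M ∧ lossProb μ c ξ S .misere .P2 = 1 - M)) ∧
    -- the escape game
    ((∀ j, MeasurableSet (winEvent c ξ S .escape .P1 j) ∧
        MeasurableSet (lossEvent c ξ S .escape .P2 j)) ∧
      MapsCube (FE χ S) ∧ MapsCube (scriptFE χ S) ∧
      IsLeast (FP (FE χ S)) (winProb μ c ξ S .escape .P1) ∧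
      (∃ M, IsGreatest (FP (scriptFE χ S)) M ∧ lossProb μ c ξ S .escape .P2 = 1 - M)) := by

  have h0 : (0 : ℝ) ∈ Set.Icc (0 : ℝ) 1 := ⟨le_rfl, zero_le_one⟩
  have h1 : (1 : ℝ) ∈ Set.Icc (0 : ℝ) 1 := ⟨zero_le_one, le_rfl⟩
  have hn {Q : Prop} : Game.normal = .escape → Q := nofun
  have hm {Q : Prop} : Game.misere = .escape → Q := nofun
  have hwin {g i} := hGW.isLeast_winProb (S := S) (g := g) (i := i) hp
  have hloss {g i} := hGW.isGreatest_one_sub_lossProb (S := S) (g := g) (i := i) hp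
  rw [FN_eq, scriptFN_eq, FM_eq, scriptFM_eq, FE_eq, scriptFE_eq]
  refine ⟨⟨fun i j => ⟨hGW.measurableSet_winEvent hn j, hGW.measurableSet_lossEvent hn j⟩,
      mapsCube_gameMap χ S _ h0 h0, mapsCube_gameMap χ S _ h0 h0,
      ?_, ⟨_, ?_, (sub_sub_cancel _ _).symm⟩, ?_, ⟨_, ?_, (sub_sub_cancel _ _).symm⟩⟩,
    ⟨fun i j => ⟨hGW.measurableSet_winEvent hm j, hGW.measurableSet_lossEvent hm j⟩,
      mapsCube_gameMap χ S _ h1 h1, mapsCube_gameMap χ S _ h1 h1,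
      ?_, ⟨_, ?_, (sub_sub_cancel _ _).symm⟩, ?_, ⟨_, ?_, (sub_sub_cancel _ _).symm⟩⟩,
    ⟨fun j => ⟨hGW.measurableSet_winEvent (fun _ => rfl) j,
        hGW.measurableSet_lossEvent (fun _ => rfl) j⟩,
      mapsCube_gameMap χ S _ h1 h0, mapsCube_gameMap χ S _ h0 h1,
      ?_, ⟨_, ?_, (sub_sub_cancel _ _).symm⟩⟩⟩
  -- Evaluating `Game.WinsIfStuck` gives the coefficients of `gameMap`: `0 0` for the normal game,
  -- `1 1` for the misère game, `1 0` for Stopper's win and `0 1` for Escaper's loss.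
  · simpa [Game.WinsIfStuck, Player.other] using hwin (g := .normal) (i := .P1) hn
  · simpa [Game.WinsIfStuck, Player.other] using hloss (g := .normal) (i := .P1) hn
  · simpa [Game.WinsIfStuck, Player.other] using hwin (g := .normal) (i := .P2) hn
  · simpa [Game.WinsIfStuck, Player.other] using hloss (g := .normal) (i := .P2) hn
  · simpa [Game.WinsIfStuck, Player.other] using hwin (g := .misere) (i := .P1) hm
  · simpa [Game.WinsIfStuck, Player.other] using hloss (g := .misere) (i := .P1) hm
  · simpa [Game.WinsIfStuck, Player.other] using hwin (g := .misere) (i := .P2) hm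
  · simpa [Game.WinsIfStuck, Player.other] using hloss (g := .misere) (i := .P2) hm
  · simpa [Game.WinsIfStuck, Player.other] using hwin (g := .escape) (i := .P1) fun _ => rfl
  · simpa [Game.WinsIfStuck, Player.other] using hloss (g := .escape) (i := .P2) fun _ => rfl
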